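/- Let $d\ge 1$ and $k\ge 1$ be integers and let $\lambda>0$ be real. For a finite set $V\subset\mathbb R^d$ and $r\ge 0$, let $G_r(V)$ be the graph with vertex set $V$ in which two distinct points $u,v\in V$ are joined by an edge if and only if their Euclidean distance satisfies $\|u-v\|\le r$, and let $N_{k,r}(V)$ be the maximum number of vertices of $G_r(V)$ that can be properly colored with $k$ colors, i.e. the largest cardinality of a set $W\subseteq V$ such that the subgraph of $G_r(V)$ induced by $W$ is $k$-colorable. Let $\mathcal X_\lambda$ be a homogeneous Poisson point process of intensity $\lambda$ in $\mathbb R^d$, regarded as a random locally finite set of points, and put $$F_{k,\lambda}(t)=N_{k,1}\big([0,t]^d\cap\mathcal X_\lambda\big),\qquad t\ge 0 .$$ Then $F_{k,\lambda}(t)$ is a square-integrable random variable for every $t>3$, and $$\inf_{t>3}\frac{\operatorname{Var}\big(F_{k,\lambda}(t)\big)}{t^d}>0 .$$ -/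

import Mathlib

open MeasureTheory ProbabilityTheory

/-- The geometric graph `G_r(V)`: the vertices are the points of `V`, and two distinct points are
joined if and only if their Euclidean distance is at most `r`. -/
def geometricGraph {d : ℕ} (r : ℝ) (V : Set (EuclideanSpace ℝ (Fin d))) : SimpleGraph V where
  Adj u v := u ≠ v ∧ dist u v ≤ r
  symm := ⟨fun u v h => ⟨h.1.symm, by rw [dist_comm]; exact h.2⟩⟩
  loopless := ⟨fun _ h => h.1 rfl⟩

/-- `N_{k,r}(V)`: the maximum number of vertices of `G_r(V)` that can be properly coloured with
`k` colours, i.e. the largest size of a set `W` of vertices whose induced subgraph is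
`k`-colourable. It is used for finite `V` only. -/
noncomputable def maxColored {d : ℕ} (k : ℕ) (r : ℝ) (V : Set (EuclideanSpace ℝ (Fin d))) : ℕ :=
  sSup {n : ℕ | ∃ W : Finset V,
    ((geometricGraph r V).induce (W : Set V)).Colorable k ∧ W.card = n}

/-- The cube `[0, t]^d`. -/
def cube (d : ℕ) (t : ℝ) : Set (EuclideanSpace ℝ (Fin d)) :=
  {x | ∀ i, x i ∈ Set.Icc 0 t}

/-- `X` is a (homogeneous) Poisson point process of intensity `lam` in `ℝ^d`, as a random locally
finite set of points: the number of points in a bounded Borel set is a random variable, its law is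
Poisson with mean `lam` times the Lebesgue measure of the set, and the numbers of points in
pairwise disjoint bounded Borel sets are independent. -/
structure IsPoissonProcess {Ω : Type*} [MeasurableSpace Ω] {d : ℕ} (lam : ℝ)
    (X : Ω → Set (EuclideanSpace ℝ (Fin d))) (P : Measure Ω) : Prop where
  finite_inter : ∀ ω, ∀ A : Set (EuclideanSpace ℝ (Fin d)),
    Bornology.IsBounded A → (X ω ∩ A).Finite
  measurable_count : ∀ A : Set (EuclideanSpace ℝ (Fin d)),
    Bornology.IsBounded A → MeasurableSet A → Measurable fun ω => (X ω ∩ A).ncard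
  law_count : ∀ A : Set (EuclideanSpace ℝ (Fin d)),
    Bornology.IsBounded A → MeasurableSet A →
      P.map (fun ω => (X ω ∩ A).ncard) = poissonMeasure (lam * volume.real A).toNNReal
  indep_count : ∀ (n : ℕ) (A : Fin n → Set (EuclideanSpace ℝ (Fin d))),
    (∀ i, Bornology.IsBounded (A i)) → (∀ i, MeasurableSet (A i)) →
      Pairwise (Function.onFun Disjoint A) →
        iIndepFun (fun i ω => (X ω ∩ A i).ncard) P

/-- `F_{k,lam}(t) = N_{k,1}([0, t]^d ∩ X)`, as a real random variable. -/
noncomputable def coloredCount {Ω : Type*} {d : ℕ} (k : ℕ)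
    (X : Ω → Set (EuclideanSpace ℝ (Fin d))) (t : ℝ) (ω : Ω) : ℝ :=
  (maxColored k 1 (cube d t ∩ X ω) : ℝ)

/-! Place disjoint blocks of side 3 in the cube, each with a small core whose points are at distance
more than 1 from everything outside the block. If the shell (block minus core) is empty and the core
holds a single point, that point is isolated in the graph, so it adds exactly one to the count,
whatever the configuration outside the block (`maxColored_insert`). Attach to each block its
`emptyShellScore`, a bounded mean-zero function of the points in the block. Scores of distinct
blocks are independent, and each has the same positive covariance `c` with the count, because the
count outside the block is independent of the score and drops out
(`covariance_maxColored_emptyShellScore`). A Bessel inequality (`sq_mul_card_le_variance`) bounds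
the variance below by `c ^ 2` times the number of blocks, which is of order `t ^ d`.

The process is given only through its counts. Hence the count of coloured points has to be shown
measurable for the σ-algebra `countSigma` of its window (`measurable_maxColored_countSigma`), and
these σ-algebras independent for disjoint windows (`IsPoissonProcess.indep_countSigma`). -/

/-! ### Deterministic properties of `maxColored`. -/

theorem bddAbove_colored_card {d : ℕ} (k : ℕ) (r : ℝ) {V : Set (EuclideanSpace ℝ (Fin d))}
    (hV : V.Finite) :
    BddAbove {n : ℕ | ∃ W : Finset V,
      ((geometricGraph r V).induce (W : Set V)).Colorable k ∧ W.card = n} := by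
  have := hV.fintype
  refine ⟨Fintype.card V, ?_⟩
  rintro n ⟨W, -, rfl⟩
  exact Finset.card_le_univ W

/-- Colouring the whole space avoids nested subtypes; since `0 < k`, there is a default colour for
points outside `W`. -/
theorem colorable_induce_iff {d k : ℕ} (hk : 0 < k) (r : ℝ)
    {V : Set (EuclideanSpace ℝ (Fin d))} (W : Finset V) :
    ((geometricGraph r V).induce (W : Set V)).Colorable k ↔
      ∃ c : EuclideanSpace ℝ (Fin d) → Fin k, ∀ u ∈ W, ∀ v ∈ W, u ≠ v →
        c u = c v → r < dist u v := by
  classical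
  constructor
  · rintro ⟨C⟩
    refine ⟨fun x => if hx : ∃ h : x ∈ V, (⟨x, h⟩ : V) ∈ (W : Set V)
      then C ⟨⟨x, hx.1⟩, hx.2⟩ else ⟨0, hk⟩, ?_⟩
    intro u hu v hv huv hc
    have hu' : ∃ h : (u : EuclideanSpace ℝ (Fin d)) ∈ V, (⟨u, h⟩ : V) ∈ (W : Set V) :=
      ⟨u.2, hu⟩
    have hv' : ∃ h : (v : EuclideanSpace ℝ (Fin d)) ∈ V, (⟨v, h⟩ : V) ∈ (W : Set V) :=
      ⟨v.2, hv⟩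
    simp only [dif_pos hu', dif_pos hv'] at hc
    by_contra! hle
    refine C.valid (v := ⟨u, hu⟩) (w := ⟨v, hv⟩) ?_ hc
    exact ⟨huv, hle⟩
  · rintro ⟨c, hc⟩
    refine ⟨SimpleGraph.Coloring.mk (fun x => c x.1) ?_⟩
    rintro ⟨u, hu⟩ ⟨v, hv⟩ ⟨hne, hle⟩ h
    exact absurd (hc u hu v hv hne h) (not_lt.2 hle)

/-- Lower bounds on `maxColored` are witnessed by coloured finite sets of points. -/
theorem le_maxColored_iff {d k n : ℕ} (hk : 0 < k) {r : ℝ}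
    {V : Set (EuclideanSpace ℝ (Fin d))} (hV : V.Finite) :
    n ≤ maxColored k r V ↔ ∃ W : Finset (EuclideanSpace ℝ (Fin d)), ↑W ⊆ V ∧ W.card = n ∧
      ∃ c : EuclideanSpace ℝ (Fin d) → Fin k, ∀ u ∈ W, ∀ v ∈ W, u ≠ v →
        c u = c v → r < dist u v := by
  classical
  have hb := bddAbove_colored_card k r hV
  constructor
  · intro h
    have hne : {n : ℕ | ∃ W : Finset V,
        ((geometricGraph r V).induce (W : Set V)).Colorable k ∧ W.card = n}.Nonempty :=
      ⟨0, ∅, (colorable_induce_iff hk r _).2 ⟨fun _ => ⟨0, hk⟩, by simp⟩, rfl⟩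
    obtain ⟨W, hW, hcard⟩ := Nat.sSup_mem hne hb
    obtain ⟨c, hc⟩ := (colorable_induce_iff hk r W).1 hW
    have hn : n ≤ W.card := by rw [hcard]; exact h
    -- Colourability passes to subsets, so a maximal set can be trimmed to exactly `n` points.
    obtain ⟨W', hW', rfl⟩ := Finset.exists_subset_card_eq hn
    refine ⟨W'.map (Function.Embedding.subtype _), ?_, by simp, c, ?_⟩
    · intro x hx
      simp only [Finset.coe_map, Set.mem_image] at hx
      obtain ⟨y, -, rfl⟩ := hx
      exact y.2
    · intro u hu v hv huv h
      simp only [Finset.mem_map] at hu hv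
      obtain ⟨u, hu, rfl⟩ := hu
      obtain ⟨v, hv, rfl⟩ := hv
      exact hc u (hW' hu) v (hW' hv) (fun e => huv (by rw [e])) h
  · rintro ⟨W, hWV, rfl, c, hc⟩
    refine le_csSup hb ⟨W.subtype (· ∈ V), (colorable_induce_iff hk r _).2 ⟨c, ?_⟩, ?_⟩
    · intro u hu v hv huv h
      rw [Finset.mem_subtype] at hu hv
      exact hc u hu v hv (fun e => huv (Subtype.ext e)) h
    · rw [Finset.card_subtype, Finset.filter_true_of_mem (fun x hx => hWV hx)]

theorem maxColored_le_ncard {d k : ℕ} (hk : 0 < k) (r : ℝ)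
    {V : Set (EuclideanSpace ℝ (Fin d))} (hV : V.Finite) : maxColored k r V ≤ V.ncard := by
  obtain ⟨W, hW, hcard, -⟩ := (le_maxColored_iff hk (r := r) hV).1 le_rfl
  rw [← hcard, ← Set.ncard_coe_finset]
  exact Set.ncard_le_ncard hW hV

/-- Adding an isolated vertex increases `maxColored` by one. -/
theorem maxColored_insert {d k : ℕ} (hk : 0 < k) {r : ℝ} (hr : 0 ≤ r)
    {V : Set (EuclideanSpace ℝ (Fin d))} (hV : V.Finite) {x : EuclideanSpace ℝ (Fin d)}
    (hx : ∀ y ∈ V, r < dist x y) : maxColored k r (insert x V) = maxColored k r V + 1 := by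
  classical
  have hxV : x ∉ V := fun h => by have := hx x h; rw [dist_self] at this; linarith
  apply le_antisymm
  · obtain ⟨W, hW, hcard, c, hc⟩ := (le_maxColored_iff hk (r := r) (hV.insert x)).1 le_rfl
    have : (W.erase x).card ≤ maxColored k r V := by
      refine (le_maxColored_iff hk hV).2 ⟨W.erase x, ?_, rfl, c, fun u hu v hv =>
        hc u (Finset.mem_of_mem_erase hu) v (Finset.mem_of_mem_erase hv)⟩
      intro y hy
      rw [Finset.mem_coe, Finset.mem_erase] at hy
      exact (hW hy.2).resolve_left hy.1
    have := Finset.pred_card_le_card_erase (s := W) (a := x)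
    omega
  · obtain ⟨W, hW, hcard, c, hc⟩ := (le_maxColored_iff hk (r := r) hV).1 le_rfl
    refine (le_maxColored_iff hk (hV.insert x)).2 ⟨insert x W, ?_, ?_, c, ?_⟩
    · rw [Finset.coe_insert]; exact Set.insert_subset_insert hW
    · rw [Finset.card_insert_of_notMem (fun h => hxV (hW h)), hcard]
    · intro u hu v hv huv h
      rw [Finset.mem_insert] at hu hv
      rcases hu with rfl | hu <;> rcases hv with rfl | hv
      · exact absurd rfl huv
      · exact hx v (hW hv)
      · rw [dist_comm]; exact hx u (hW hu)
      · exact hc u hu v hv huv h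

/-- A lower bound on `maxColored` can be read off from which members of a countable basis of the
topology contain a point of the configuration. -/
theorem le_maxColored_iff_basis {d k n : ℕ} (hk : 0 < k) {r : ℝ}
    {V : Set (EuclideanSpace ℝ (Fin d))} (hV : V.Finite) :
    n ≤ maxColored k r V ↔
      ∃ p : (Fin n → TopologicalSpace.countableBasis (EuclideanSpace ℝ (Fin d))) × (Fin n → Fin k),
        (∀ y : Fin n → EuclideanSpace ℝ (Fin d), (∀ i, y i ∈ (p.1 i : Set _)) →
          ∀ i j, i ≠ j → y i ≠ y j ∧ (p.2 i = p.2 j → r < dist (y i) (y j))) ∧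
        ∀ i, (V ∩ (p.1 i : Set _)).Nonempty := by
  classical
  rw [le_maxColored_iff hk hV]
  constructor
  · rintro ⟨W, hW, rfl, c, hc⟩
    let x : Fin W.card → EuclideanSpace ℝ (Fin d) := fun i => (W.equivFin.symm i : W)
    have hxW : ∀ i, x i ∈ W := fun i => (W.equivFin.symm i).2
    have hxi : Function.Injective x := Subtype.val_injective.comp W.equivFin.symm.injective
    -- Adjacency is a closed condition, so properly coloured tuples of distinct points form an open
    -- set, which contains a product of basic open sets around `x`.
    let U : Set (Fin W.card → EuclideanSpace ℝ (Fin d)) :=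
      {y | ∀ i j, i ≠ j → y i ≠ y j ∧ (c (x i) = c (x j) → r < dist (y i) (y j))}
    have hU : IsOpen U := by
      simp only [U, Set.ofPred_forall]
      refine isOpen_iInter_of_finite fun i => isOpen_iInter_of_finite fun j =>
        isOpen_iInter_of_finite fun _ => ?_
      rw [Set.ofPred_and]
      refine (isOpen_ne_fun (by fun_prop) (by fun_prop)).inter ?_
      rw [Set.ofPred_forall]
      exact isOpen_iInter_of_finite fun _ => isOpen_lt (by fun_prop) (by fun_prop)
    have hxU : x ∈ U := fun i j hij =>
      ⟨hxi.ne hij, hc _ (hxW i) _ (hxW j) (hxi.ne hij)⟩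
    obtain ⟨u, hu, huU⟩ := isOpen_pi_iff'.1 hU x hxU
    choose b hb hxb hbu using fun i =>
      (TopologicalSpace.isBasis_countableBasis (EuclideanSpace ℝ (Fin d))).exists_subset_of_mem_open
        (hu i).2 (hu i).1
    refine ⟨(fun i => ⟨b i, hb i⟩, fun i => c (x i)), ?_, fun i => ⟨x i, hW (hxW i), hxb i⟩⟩
    intro y hy
    exact huU (fun i _ => hbu i (hy i))
  · rintro ⟨⟨b, c⟩, hsep, hne⟩
    choose x hxV hxb using hne
    have hx := hsep x hxb
    have hxi : Function.Injective x := fun i j hij => by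
      by_contra hne
      exact (hx i j hne).1 hij
    refine ⟨Finset.univ.image x, ?_, ?_, Function.extend x c fun _ => ⟨0, hk⟩, ?_⟩
    · intro y hy
      simp only [Finset.coe_image, Finset.coe_univ, Set.image_univ, Set.mem_range] at hy
      obtain ⟨i, rfl⟩ := hy
      exact hxV i
    · rw [Finset.card_image_of_injective _ hxi, Finset.card_univ, Fintype.card_fin]
    · intro u hu v hv huv h
      simp only [Finset.mem_image, Finset.mem_univ, true_and] at hu hv
      obtain ⟨i, rfl⟩ := hu
      obtain ⟨j, rfl⟩ := hv
      rw [hxi.extend_apply, hxi.extend_apply] at h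
      exact (hx i j (fun e => huv (by rw [e]))).2 h

/-! ### Measurability and independence through counts. -/

section Counts

variable {Ω : Type*} {d : ℕ}

/-- The σ-algebra generated by the numbers of points in the Borel subsets of `D`. -/
@[reducible]
noncomputable def countSigma (X : Ω → Set (EuclideanSpace ℝ (Fin d))) (D : Set (EuclideanSpace ℝ (Fin d))) :
    MeasurableSpace Ω :=
  ⨆ A : {A : Set (EuclideanSpace ℝ (Fin d)) // MeasurableSet A ∧ A ⊆ D},
    MeasurableSpace.comap (fun ω => (X ω ∩ A).ncard) inferInstance

theorem measurable_ncard_countSigma {X : Ω → Set (EuclideanSpace ℝ (Fin d))}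
    {D A : Set (EuclideanSpace ℝ (Fin d))} (hA : MeasurableSet A) (hAD : A ⊆ D) :
    Measurable[countSigma X D] fun ω => (X ω ∩ A).ncard :=
  Measurable.mono (comap_measurable _)
    (le_iSup (fun A : {A : Set (EuclideanSpace ℝ (Fin d)) // MeasurableSet A ∧ A ⊆ D} =>
      MeasurableSpace.comap (fun ω => (X ω ∩ A).ncard) inferInstance) ⟨A, hA, hAD⟩) le_rfl

/-- By `le_maxColored_iff_basis`, each event `n ≤ maxColored` is a countable union of finite
intersections of events that some Borel subset of `D` contains a point. -/
theorem measurable_maxColored_countSigma {X : Ω → Set (EuclideanSpace ℝ (Fin d))}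
    {D : Set (EuclideanSpace ℝ (Fin d))} (hfin : ∀ ω, (X ω ∩ D).Finite) (hD : MeasurableSet D)
    {k : ℕ} (hk : 0 < k) (r : ℝ) :
    Measurable[countSigma X D] fun ω => maxColored k r (D ∩ X ω) := by
  let _ : MeasurableSpace Ω := countSigma X D
  refine measurable_of_Ici fun n => ?_
  have hfin' : ∀ ω, (D ∩ X ω).Finite := fun ω => by rw [Set.inter_comm]; exact hfin ω
  let S := {p : (Fin n → TopologicalSpace.countableBasis (EuclideanSpace ℝ (Fin d))) ×
      (Fin n → Fin k) // ∀ y : Fin n → EuclideanSpace ℝ (Fin d), (∀ i, y i ∈ (p.1 i : Set _)) →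
          ∀ i j, i ≠ j → y i ≠ y j ∧ (p.2 i = p.2 j → r < dist (y i) (y j))}
  have : (fun ω => maxColored k r (D ∩ X ω)) ⁻¹' Set.Ici n =
      ⋃ p : S, ⋂ i, {ω | (X ω ∩ (D ∩ (p.1.1 i : Set _))).ncard ≠ 0} := by
    ext ω
    simp only [Set.mem_preimage, Set.mem_Ici, Set.mem_iUnion, Set.mem_iInter, Set.mem_ofPred_eq,
      le_maxColored_iff_basis hk (hfin' ω), S, Subtype.exists, exists_prop]
    refine exists_congr fun p => and_congr_right fun _ => forall_congr' fun i => ?_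
    rw [← Set.inter_assoc, Set.inter_comm (X ω) D, ← Nat.pos_iff_ne_zero,
      Set.ncard_pos ((hfin' ω).subset Set.inter_subset_left)]
  rw [this]
  refine MeasurableSet.iUnion fun p => MeasurableSet.iInter fun i => ?_
  have hm := measurable_ncard_countSigma (X := X) (D := D)
    (hD.inter (TopologicalSpace.isOpen_of_mem_countableBasis (p.1.1 i).2).measurableSet)
    Set.inter_subset_left
  exact hm (MeasurableSet.of_discrete (s := {m : ℕ | m ≠ 0}))

/-- The atom of `D` on which membership in the sets of the family `s` is prescribed by `u`. -/
def familyAtom (D : Set (EuclideanSpace ℝ (Fin d)))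
    (s : Finset {A : Set (EuclideanSpace ℝ (Fin d)) // MeasurableSet A ∧ A ⊆ D})
    (u : s → Prop) : Set (EuclideanSpace ℝ (Fin d)) :=
  {x | x ∈ D ∧ ∀ A : s, x ∈ A.1.1 ↔ u A}

theorem measurableSet_familyAtom {D : Set (EuclideanSpace ℝ (Fin d))} (hD : MeasurableSet D)
    (s : Finset {A : Set (EuclideanSpace ℝ (Fin d)) // MeasurableSet A ∧ A ⊆ D}) (u : s → Prop) :
    MeasurableSet (familyAtom D s u) := by
  refine MeasurableSet.inter hD ?_
  change MeasurableSet {x | ∀ A : s, x ∈ A.1.1 ↔ u A}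
  rw [Set.ofPred_forall]
  refine MeasurableSet.iInter fun A => ?_
  by_cases h : u A
  · simpa [h] using A.1.2.1
  · simp only [h, iff_false]
    exact A.1.2.1.compl

theorem disjoint_familyAtom {D : Set (EuclideanSpace ℝ (Fin d))}
    (s : Finset {A : Set (EuclideanSpace ℝ (Fin d)) // MeasurableSet A ∧ A ⊆ D})
    {u v : s → Prop} (huv : u ≠ v) : Disjoint (familyAtom D s u) (familyAtom D s v) := by
  refine Set.disjoint_left.2 fun x hx hy => huv (funext fun A => propext ?_)
  rw [← hx.2 A, hy.2 A]

-- The atoms whose prescription `u` holds at `A` partition `A`.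
open Classical in
theorem ncard_inter_eq_sum_familyAtom {D : Set (EuclideanSpace ℝ (Fin d))}
    (s : Finset {A : Set (EuclideanSpace ℝ (Fin d)) // MeasurableSet A ∧ A ⊆ D}) (A : s)
    {V : Set (EuclideanSpace ℝ (Fin d))} (hV : (V ∩ D).Finite) :
    (V ∩ A.1.1).ncard = ∑ u : s → Prop with u A, (V ∩ familyAtom D s u).ncard := by
  have hVA : (V ∩ A.1.1).Finite := hV.subset (Set.inter_subset_inter_right _ A.1.2.2)
  rw [Set.ncard_eq_toFinset_card _ hVA, Finset.card_eq_sum_card_fiberwise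
    (f := fun x (A' : s) => x ∈ A'.1.1) (t := Finset.univ.filter fun u : s → Prop => u A)]
  · refine Finset.sum_congr rfl fun u hu => ?_
    rw [← Set.ncard_coe_finset]
    congr 1
    ext x
    simp only [Finset.coe_filter, Set.Finite.mem_toFinset, Set.mem_ofPred_eq, familyAtom,
      Set.mem_inter_iff]
    rw [Finset.mem_filter] at hu
    constructor
    · rintro ⟨⟨h1, h2⟩, rfl⟩
      exact ⟨h1, A.1.2.2 h2, fun _ => Iff.rfl⟩
    · rintro ⟨h1, h2, h3⟩
      exact ⟨⟨h1, (h3 A).2 hu.2⟩, funext fun B => propext (h3 B)⟩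
  · intro x hx
    simp only [Set.Finite.coe_toFinset] at hx
    simpa using hx.2

/-- Passes from a finite family of overlapping sets to its disjoint atoms, the only sets for which
independence of the counts is assumed. -/
theorem iSup_comap_ncard_le {D : Set (EuclideanSpace ℝ (Fin d))}
    {X : Ω → Set (EuclideanSpace ℝ (Fin d))}
    (s : Finset {A : Set (EuclideanSpace ℝ (Fin d)) // MeasurableSet A ∧ A ⊆ D})
    (hfin : ∀ ω, (X ω ∩ D).Finite) {m : MeasurableSpace Ω}
    (hm : ∀ u, Measurable[m] fun ω => (X ω ∩ familyAtom D s u).ncard) :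
    ⨆ A ∈ s, MeasurableSpace.comap (fun ω => (X ω ∩ A.1).ncard) inferInstance ≤ m := by
  classical
  refine iSup₂_le fun A hA => Measurable.comap_le ?_
  have := fun ω => ncard_inter_eq_sum_familyAtom s ⟨A, hA⟩ (hfin ω)
  simp_rw [this]
  exact Finset.measurable_sum _ fun u _ => hm u

variable [MeasurableSpace Ω] {P : Measure Ω} {X : Ω → Set (EuclideanSpace ℝ (Fin d))} {lam : ℝ}

theorem IsPoissonProcess.countSigma_le (hX : IsPoissonProcess lam X P)
    {D : Set (EuclideanSpace ℝ (Fin d))} (hD : Bornology.IsBounded D) :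
    countSigma X D ≤ ‹MeasurableSpace Ω› :=
  iSup_le fun A => (hX.measurable_count A.1 (hD.subset A.2.2) A.2.1).comap_le

theorem IsPoissonProcess.iIndepFun_count (hX : IsPoissonProcess lam X P) {ι : Type*} [Finite ι]
    {A : ι → Set (EuclideanSpace ℝ (Fin d))} (hb : ∀ i, Bornology.IsBounded (A i))
    (hm : ∀ i, MeasurableSet (A i)) (hd : Pairwise (Function.onFun Disjoint A)) :
    iIndepFun (fun i ω => (X ω ∩ A i).ncard) P := by
  have e := Finite.equivFin ι
  have h := hX.indep_count (Nat.card ι) (A ∘ e.symm) (fun _ => hb _) (fun _ => hm _)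
    (hd.comp_of_injective e.symm.injective)
  have := h.precomp e.injective
  simpa [Function.comp_def] using this

/-- The restrictions of a Poisson process to disjoint bounded Borel sets are independent. -/
theorem IsPoissonProcess.indep_countSigma [IsProbabilityMeasure P]
    (hX : IsPoissonProcess lam X P) {D E : Set (EuclideanSpace ℝ (Fin d))}
    (hDb : Bornology.IsBounded D) (hEb : Bornology.IsBounded E)
    (hD : MeasurableSet D) (hE : MeasurableSet E) (hDE : Disjoint D E) :
    Indep (countSigma X D) (countSigma X E) P := by
  classical
  have hle : ∀ {D : Set (EuclideanSpace ℝ (Fin d))} (_ : Bornology.IsBounded D)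
      (A : {A : Set (EuclideanSpace ℝ (Fin d)) // MeasurableSet A ∧ A ⊆ D}),
      MeasurableSpace.comap (fun ω => (X ω ∩ A).ncard) inferInstance ≤ ‹MeasurableSpace Ω› :=
    fun hD A => (hX.measurable_count A.1 (hD.subset A.2.2) A.2.1).comap_le
  have hdir : ∀ D : Set (EuclideanSpace ℝ (Fin d)), Directed (· ≤ ·)
      fun s : Finset {A : Set (EuclideanSpace ℝ (Fin d)) // MeasurableSet A ∧ A ⊆ D} =>
        ⨆ A ∈ s, MeasurableSpace.comap (fun ω => (X ω ∩ A.1).ncard) inferInstance := by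
    intro D
    refine Monotone.directed_le fun s t hst => biSup_mono fun A hA => Finset.mem_of_subset hst hA
  -- Each σ-algebra is a directed supremum over finite subfamilies, so it suffices to treat finite
  -- families `s` and `t`.
  rw [countSigma, countSigma, iSup_eq_iSup_finset, iSup_eq_iSup_finset (ι := {A // _ ∧ A ⊆ E})]
  refine indep_iSup_of_directed_le (fun s => ?_) (fun s => iSup₂_le fun A _ => hle hDb A)
    (iSup_le fun s => iSup₂_le fun A _ => hle hEb A) (hdir D)
  refine (indep_iSup_of_directed_le (fun t => ?_) (fun s => iSup₂_le fun A _ => hle hEb A)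
    (iSup₂_le fun A _ => hle hDb A) (hdir E)).symm
  -- The atoms of both families together are pairwise disjoint, so all their counts are jointly
  -- independent.
  let A : (s → Prop) ⊕ (t → Prop) → Set (EuclideanSpace ℝ (Fin d)) :=
    Sum.elim (familyAtom D s) (familyAtom E t)
  have hA := hX.iIndepFun_count (A := A)
    (by rintro (u | u); exacts [hDb.subset fun x hx => hx.1, hEb.subset fun x hx => hx.1])
    (by rintro (u | u); exacts [measurableSet_familyAtom hD s u, measurableSet_familyAtom hE t u])
    (by
      rintro (u | u) (v | v) huv
      · exact disjoint_familyAtom s fun h => huv (by rw [h])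
      · exact hDE.mono (fun x hx => hx.1) fun x hx => hx.1
      · exact hDE.symm.mono (fun x hx => hx.1) fun x hx => hx.1
      · exact disjoint_familyAtom t fun h => huv (by rw [h]))
  have hAm : ∀ i, Measurable fun ω => (X ω ∩ A i).ncard := by
    rintro (u | u)
    · exact hX.measurable_count _ (hDb.subset fun x hx => hx.1) (measurableSet_familyAtom hD s u)
    · exact hX.measurable_count _ (hEb.subset fun x hx => hx.1) (measurableSet_familyAtom hE t u)
  have hind := indep_iSup_of_disjoint (fun i => (hAm i).comap_le) hA.iIndep
    (S := Set.range Sum.inl) (T := Set.range Sum.inr) Set.isCompl_range_inl_range_inr.disjoint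
  refine (indep_of_indep_of_le_left (indep_of_indep_of_le_right hind ?_) ?_).symm
  · refine iSup_comap_ncard_le t (fun ω => hX.finite_inter ω E hEb) fun u => Measurable.mono (comap_measurable _) ?_ le_rfl
    exact le_iSup₂_of_le (Sum.inr u) ⟨u, rfl⟩ le_rfl
  · refine iSup_comap_ncard_le s (fun ω => hX.finite_inter ω D hDb) fun u => Measurable.mono (comap_measurable _) ?_ le_rfl
    exact le_iSup₂_of_le (Sum.inl u) ⟨u, rfl⟩ le_rfl

end Counts

/-! ### A Bessel inequality and Poisson second moments. -/

section Abstract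

variable {Ω : Type*} [MeasurableSpace Ω] {P : Measure Ω}

/-- A lower bound of Bessel type for the variance, in terms of the covariances with uncorrelated
random variables. -/
theorem sq_mul_card_le_variance [IsProbabilityMeasure P] {ι : Type*} [Fintype ι] {F : Ω → ℝ}
    (hF : MemLp F 2 P) {g : ι → Ω → ℝ} (hg : ∀ i, MemLp (g i) 2 P)
    (hun : ∀ i j, i ≠ j → cov[g i, g j; P] = 0) (hvar : ∀ i, Var[g i; P] ≤ 1)
    {c : ℝ} (hcov : ∀ i, cov[F, g i; P] = c) :
    c ^ 2 * Fintype.card ι ≤ Var[F; P] := by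
  classical
  have hG : MemLp (∑ i, g i) 2 P := memLp_finsetSum' _ fun i _ => hg i
  have h1 : cov[F, ∑ i, g i; P] = Fintype.card ι * c := by
    rw [covariance_sum_right hg hF]
    simp [hcov]
  have h2 : Var[∑ i, g i; P] ≤ Fintype.card ι := by
    rw [← covariance_self hG.aestronglyMeasurable.aemeasurable, covariance_sum_sum hg hg]
    calc ∑ i, ∑ j, cov[g i, g j; P] = ∑ i, Var[g i; P] := by
          refine Finset.sum_congr rfl fun i _ => ?_
          rw [Finset.sum_eq_single i (fun j _ hj => hun i j hj.symm) (by simp),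
            covariance_self (hg i).aestronglyMeasurable.aemeasurable]
      _ ≤ ∑ _i : ι, (1 : ℝ) := Finset.sum_le_sum fun i _ => hvar i
      _ = Fintype.card ι := by simp
  -- With `n` functions `g i` and sum `G`, this expands to `Var F - 2 * c * (n * c) + c ^ 2 * Var G
  -- ≥ 0`, where `Var G ≤ n`.
  have h3 := variance_nonneg (F - c • ∑ i, g i) P
  rw [variance_sub hF (hG.const_smul c), variance_smul, covariance_smul_right, h1] at h3
  nlinarith [mul_le_mul_of_nonneg_left h2 (sq_nonneg c)]

/-- Since `n ^ 2 ≤ 4 ^ n`, the second-moment series is dominated by an exponential series. -/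
theorem memLp_two_natCast_poissonMeasure (r : NNReal) :
    MemLp (fun n : ℕ => (n : ℝ)) 2 (poissonMeasure r) := by
  refine (memLp_two_iff_integrable_sq .of_discrete).2 (integrable_poissonMeasure_iff.2 ?_)
  refine Summable.of_nonneg_of_le (fun n => by positivity) (fun n => ?_)
    ((Real.summable_pow_div_factorial (4 * r)).mul_left (Real.exp (-r)))
  have h : ((n : ℝ)) ^ 2 ≤ 4 ^ n := by
    have : (n : ℝ) ≤ 2 ^ n := by exact_mod_cast Nat.lt_two_pow_self.le
    calc ((n : ℝ)) ^ 2 ≤ (2 ^ n) ^ 2 := by gcongr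
      _ = 4 ^ n := by rw [← pow_mul, mul_comm, pow_mul]; norm_num
  rw [Real.norm_of_nonneg (by positivity)]
  calc Real.exp (-r) * r ^ n / n.factorial * (n : ℝ) ^ 2
      ≤ Real.exp (-r) * r ^ n / n.factorial * 4 ^ n := by gcongr
    _ = Real.exp (-r) * ((4 * r) ^ n / n.factorial) := by rw [mul_pow]; ring

end Abstract

/-! ### Laws, integrability and independence for the process. -/

section Moments

variable {Ω : Type*} [MeasurableSpace Ω] {P : Measure Ω} {d : ℕ}
  {X : Ω → Set (EuclideanSpace ℝ (Fin d))} {lam : ℝ}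

theorem IsPoissonProcess.measureReal_ncard_eq (hX : IsPoissonProcess lam X P)
    {A : Set (EuclideanSpace ℝ (Fin d))} (hb : Bornology.IsBounded A) (hm : MeasurableSet A)
    (n : ℕ) : P.real {ω | (X ω ∩ A).ncard = n} =
      (poissonMeasure (lam * volume.real A).toNNReal).real {n} := by
  rw [← hX.law_count A hb hm, map_measureReal_apply (hX.measurable_count A hb hm) .of_discrete]
  rfl

theorem IsPoissonProcess.memLp_ncard (hX : IsPoissonProcess lam X P)
    {A : Set (EuclideanSpace ℝ (Fin d))} (hb : Bornology.IsBounded A) (hm : MeasurableSet A) :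
    MemLp (fun ω => ((X ω ∩ A).ncard : ℝ)) 2 P := by
  have := memLp_two_natCast_poissonMeasure (lam * volume.real A).toNNReal
  rw [← hX.law_count A hb hm] at this
  exact this.comp_of_map (hX.measurable_count A hb hm).aemeasurable

theorem IsPoissonProcess.memLp_maxColored (hX : IsPoissonProcess lam X P)
    {D : Set (EuclideanSpace ℝ (Fin d))} (hb : Bornology.IsBounded D) (hm : MeasurableSet D)
    {k : ℕ} (hk : 0 < k) (r : ℝ) :
    MemLp (fun ω => (maxColored k r (D ∩ X ω) : ℝ)) 2 P := by
  have hmeas := Measurable.mono (measurable_maxColored_countSigma (X := X)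
    (fun ω => hX.finite_inter ω D hb) hm hk r) (hX.countSigma_le hb) le_rfl
  refine (hX.memLp_ncard hb hm).mono
    ((measurable_from_nat (f := fun n : ℕ => (n : ℝ))).comp hmeas).aestronglyMeasurable
    (Filter.Eventually.of_forall fun ω => ?_)
  rw [Real.norm_of_nonneg (by positivity), Real.norm_of_nonneg (by positivity), Set.inter_comm]
  exact_mod_cast maxColored_le_ncard hk r (hX.finite_inter ω D hb)

theorem IsPoissonProcess.indepFun_of_disjoint [IsProbabilityMeasure P]
    (hX : IsPoissonProcess lam X P) {D E : Set (EuclideanSpace ℝ (Fin d))}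
    (hDb : Bornology.IsBounded D) (hEb : Bornology.IsBounded E)
    (hD : MeasurableSet D) (hE : MeasurableSet E) (hDE : Disjoint D E) {f g : Ω → ℝ}
    (hf : Measurable[countSigma X D] f) (hg : Measurable[countSigma X E] g) : IndepFun f g P :=
  (IndepFun_iff_Indep f g P).2 <| indep_of_indep_of_le_left
    (indep_of_indep_of_le_right (hX.indep_countSigma hDb hEb hD hE hDE) hg.comap_le) hf.comap_le

end Moments

/-! ### The score of one block and its covariance with the count. -/

section Local

/-- The product of `1{m = 0}` and a function of `n` that vanishes outside `{0, 1}` and has mean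
zero when `0` and `1` have probabilities `p₀` and `p₁`. -/
noncomputable def emptyShellScore (p₀ p₁ : ℝ) (m n : ℕ) : ℝ :=
  (if m = 0 then 1 else 0) * ((if n = 1 then p₀ else 0) - if n = 0 then p₁ else 0)

theorem abs_emptyShellScore_le {p₀ p₁ : ℝ} (h₀ : 0 ≤ p₀) (h₀' : p₀ ≤ 1) (h₁ : 0 ≤ p₁)
    (h₁' : p₁ ≤ 1) (m n : ℕ) : |emptyShellScore p₀ p₁ m n| ≤ 1 := by
  unfold emptyShellScore
  rw [abs_le]
  split_ifs <;> first | omega | constructor <;> linarith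

theorem measurable_emptyShellScore {Ω : Type*} {d : ℕ}
    {X : Ω → Set (EuclideanSpace ℝ (Fin d))} {S B Q : Set (EuclideanSpace ℝ (Fin d))}
    (hS : MeasurableSet S) (hB : MeasurableSet B) (hSQ : S ⊆ Q) (hBQ : B ⊆ Q) (p₀ p₁ : ℝ) :
    Measurable[countSigma X Q]
      fun ω => emptyShellScore p₀ p₁ (X ω ∩ S).ncard (X ω ∩ B).ncard := by
  let _ : MeasurableSpace Ω := countSigma X Q
  have h : Measurable fun x : ℕ × ℕ => emptyShellScore p₀ p₁ x.1 x.2 := .of_discrete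
  exact h.comp ((measurable_ncard_countSigma hS hSQ).prodMk (measurable_ncard_countSigma hB hBQ))

variable {Ω : Type*} [MeasurableSpace Ω] {P : Measure Ω} [IsProbabilityMeasure P] {d : ℕ}
  {X : Ω → Set (EuclideanSpace ℝ (Fin d))} {lam : ℝ}

theorem IsPoissonProcess.integral_ite_ncard_mul_ite_ncard (hX : IsPoissonProcess lam X P)
    {S B : Set (EuclideanSpace ℝ (Fin d))} (hSb : Bornology.IsBounded S)
    (hBb : Bornology.IsBounded B) (hS : MeasurableSet S) (hB : MeasurableSet B)
    (hSB : Disjoint S B) (m n : ℕ) :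
    Integrable (fun ω => (if (X ω ∩ S).ncard = m then (1 : ℝ) else 0) *
        if (X ω ∩ B).ncard = n then 1 else 0) P ∧
      ∫ ω, (if (X ω ∩ S).ncard = m then (1 : ℝ) else 0) *
        (if (X ω ∩ B).ncard = n then 1 else 0) ∂P =
      P.real {ω | (X ω ∩ S).ncard = m} * P.real {ω | (X ω ∩ B).ncard = n} := by
  have hmeas : ∀ (A : Set (EuclideanSpace ℝ (Fin d))) (hA : MeasurableSet A) (l : ℕ),
      Measurable[countSigma X A] fun ω => if (X ω ∩ A).ncard = l then (1 : ℝ) else 0 :=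
    fun A hA l => (Measurable.of_discrete (f := fun j : ℕ => if j = l then (1 : ℝ) else 0)).comp
      (measurable_ncard_countSigma hA subset_rfl)
  have hint : ∀ (A : Set (EuclideanSpace ℝ (Fin d))) (_ : MeasurableSet A)
      (_ : Bornology.IsBounded A) (l : ℕ),
      ∫ ω, (if (X ω ∩ A).ncard = l then (1 : ℝ) else 0) ∂P =
        P.real {ω | (X ω ∩ A).ncard = l} := by
    intro A hA hAb l
    have hset : MeasurableSet {ω | (X ω ∩ A).ncard = l} :=
      hX.measurable_count A hAb hA (MeasurableSet.of_discrete (s := {l}))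
    rw [← integral_indicator_one hset]
    refine integral_congr_ae (Filter.Eventually.of_forall fun ω => ?_)
    simp [Set.indicator_apply]
  have hmS := (hmeas S hS m).mono (hX.countSigma_le hSb) le_rfl
  have hmB := (hmeas B hB n).mono (hX.countSigma_le hBb) le_rfl
  constructor
  · refine Integrable.of_bound (hmS.mul hmB).aestronglyMeasurable 1
      (Filter.Eventually.of_forall fun ω => ?_)
    split_ifs <;> simp
  · rw [(hX.indepFun_of_disjoint hSb hBb hS hB hSB (hmeas S hS m)
      (hmeas B hB n)).integral_fun_mul_eq_mul_integral hmS.aestronglyMeasurable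
      hmB.aestronglyMeasurable, hint S hS hSb, hint B hB hBb]

/-- Independence of shell and core turns the mean into `q * (p₀ * p₁ - p₁ * p₀)`, with `q` the
probability of an empty shell. -/
theorem IsPoissonProcess.integral_emptyShellScore (hX : IsPoissonProcess lam X P)
    {S B : Set (EuclideanSpace ℝ (Fin d))} (hSb : Bornology.IsBounded S)
    (hBb : Bornology.IsBounded B) (hS : MeasurableSet S) (hB : MeasurableSet B)
    (hSB : Disjoint S B) :
    ∫ ω, emptyShellScore (P.real {ω | (X ω ∩ B).ncard = 0}) (P.real {ω | (X ω ∩ B).ncard = 1})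
      (X ω ∩ S).ncard (X ω ∩ B).ncard ∂P = 0 := by
  set p₀ := P.real {ω | (X ω ∩ B).ncard = 0} with hp₀
  set p₁ := P.real {ω | (X ω ∩ B).ncard = 1} with hp₁
  obtain ⟨i0, e0⟩ := hX.integral_ite_ncard_mul_ite_ncard hSb hBb hS hB hSB 0 0
  obtain ⟨i1, e1⟩ := hX.integral_ite_ncard_mul_ite_ncard hSb hBb hS hB hSB 0 1
  have : ∀ m n, emptyShellScore p₀ p₁ m n =
      p₀ * ((if m = 0 then (1 : ℝ) else 0) * if n = 1 then 1 else 0) -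
      p₁ * ((if m = 0 then (1 : ℝ) else 0) * if n = 0 then 1 else 0) := by
    intro m n
    unfold emptyShellScore
    split_ifs <;> ring
  simp_rw [this]
  rw [integral_sub (i1.const_mul _) (i0.const_mul _), integral_const_mul, integral_const_mul, e0,
    e1, ← hp₀, ← hp₁]
  ring

/-- On the event that the shell `S` is empty and `B` has at most one point, the points in `B` add
their number to `maxColored`, if the points of `B` are at distance larger than `r` from `D`. -/
theorem maxColored_mul_emptyShellScore {k : ℕ} (hk : 0 < k) {r : ℝ} (hr : 0 ≤ r)
    {C D S B V : Set (EuclideanSpace ℝ (Fin d))} (hC : C = D ∪ (S ∪ B))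
    (hfin : (V ∩ C).Finite) (hdist : ∀ x ∈ B, ∀ y ∈ D, r < dist x y) (p₀ p₁ : ℝ) :
    (maxColored k r (C ∩ V) : ℝ) * emptyShellScore p₀ p₁ (V ∩ S).ncard (V ∩ B).ncard =
      maxColored k r (D ∩ V) * emptyShellScore p₀ p₁ (V ∩ S).ncard (V ∩ B).ncard +
      p₀ * ((if (V ∩ S).ncard = 0 then 1 else 0) * if (V ∩ B).ncard = 1 then 1 else 0) := by
  -- With a nonempty shell, all three terms vanish.
  by_cases hS : (V ∩ S).ncard = 0
  swap
  · simp [emptyShellScore, hS]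
  have hSC : S ⊆ C := hC ▸ fun x hx => Or.inr (Or.inl hx)
  have hBC : B ⊆ C := hC ▸ fun x hx => Or.inr (Or.inr hx)
  have hDC : D ⊆ C := hC ▸ fun x hx => Or.inl hx
  have hS' := (Set.ncard_eq_zero (hfin.subset (Set.inter_subset_inter_right _ hSC))).1 hS
  have hCV : C ∩ V = (V ∩ B) ∪ (D ∩ V) := by
    rw [hC, Set.union_inter_distrib_right, Set.union_inter_distrib_right, Set.inter_comm S,
      hS', Set.empty_union, Set.union_comm, Set.inter_comm B]
  by_cases hB0 : (V ∩ B).ncard = 0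
  · have hB' := (Set.ncard_eq_zero (hfin.subset (Set.inter_subset_inter_right _ hBC))).1 hB0
    rw [hCV, hB', Set.empty_union]
    simp
  by_cases hB1 : (V ∩ B).ncard = 1
  · obtain ⟨x, hx⟩ := Set.ncard_eq_one.1 hB1
    have hxB : x ∈ B := (hx.symm ▸ Set.mem_singleton x : x ∈ V ∩ B).2
    have hDV : (D ∩ V).Finite := by
      rw [Set.inter_comm]; exact hfin.subset (Set.inter_subset_inter_right _ hDC)
    rw [hCV, hx, Set.singleton_union,
      maxColored_insert hk hr hDV fun y hy => hdist x hxB y hy.1]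
    simp [emptyShellScore, hS]
    ring
  · simp [emptyShellScore, hB0, hB1]

theorem IsPoissonProcess.memLp_emptyShellScore (hX : IsPoissonProcess lam X P)
    {S B : Set (EuclideanSpace ℝ (Fin d))} (hSb : Bornology.IsBounded S)
    (hBb : Bornology.IsBounded B) (hS : MeasurableSet S) (hB : MeasurableSet B)
    {p₀ p₁ : ℝ} (h₀ : 0 ≤ p₀) (h₀' : p₀ ≤ 1) (h₁ : 0 ≤ p₁) (h₁' : p₁ ≤ 1) :
    MemLp (fun ω => emptyShellScore p₀ p₁ (X ω ∩ S).ncard (X ω ∩ B).ncard) 2 P :=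
  MemLp.of_bound ((measurable_emptyShellScore hS hB Set.subset_union_left
    Set.subset_union_right p₀ p₁).mono (hX.countSigma_le (hSb.union hBb))
      le_rfl).aestronglyMeasurable 1
    (Filter.Eventually.of_forall fun _ => abs_emptyShellScore_le h₀ h₀' h₁ h₁' _ _)

/-- Integrate `maxColored_mul_emptyShellScore`: the term in `D` is a product of independent factors,
one of mean zero, so only the probability of an empty shell and a single core point survives,
weighted by `p₀`. -/
theorem IsPoissonProcess.covariance_maxColored_emptyShellScore (hX : IsPoissonProcess lam X P)
    {k : ℕ} (hk : 0 < k) {r : ℝ} (hr : 0 ≤ r)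
    {C D S B : Set (EuclideanSpace ℝ (Fin d))} (hC : C = D ∪ (S ∪ B))
    (hCb : Bornology.IsBounded C) (hD : MeasurableSet D) (hS : MeasurableSet S)
    (hB : MeasurableSet B) (hSB : Disjoint S B) (hDSB : Disjoint D (S ∪ B))
    (hdist : ∀ x ∈ B, ∀ y ∈ D, r < dist x y) :
    cov[fun ω => (maxColored k r (C ∩ X ω) : ℝ), fun ω => emptyShellScore
      (P.real {ω | (X ω ∩ B).ncard = 0}) (P.real {ω | (X ω ∩ B).ncard = 1})
      (X ω ∩ S).ncard (X ω ∩ B).ncard; P] =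
    P.real {ω | (X ω ∩ B).ncard = 0} *
      (P.real {ω | (X ω ∩ S).ncard = 0} * P.real {ω | (X ω ∩ B).ncard = 1}) := by
  have hSb : Bornology.IsBounded S := hCb.subset (hC ▸ fun x hx => Or.inr (Or.inl hx))
  have hBb : Bornology.IsBounded B := hCb.subset (hC ▸ fun x hx => Or.inr (Or.inr hx))
  have hDb : Bornology.IsBounded D := hCb.subset (hC ▸ fun x hx => Or.inl hx)
  have hCm : MeasurableSet C := hC ▸ hD.union (hS.union hB)
  have hF := hX.memLp_maxColored hCb hCm hk r
  have hFD := hX.memLp_maxColored hDb hD hk r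
  have hmean := hX.integral_emptyShellScore hSb hBb hS hB hSB
  obtain ⟨i1, e1⟩ := hX.integral_ite_ncard_mul_ite_ncard hSb hBb hS hB hSB 0 1
  have hg := hX.memLp_emptyShellScore hSb hBb hS hB
    (measureReal_nonneg (μ := P) (s := {ω | (X ω ∩ B).ncard = 0})) measureReal_le_one
    (measureReal_nonneg (μ := P) (s := {ω | (X ω ∩ B).ncard = 1})) measureReal_le_one
  set p₀ := P.real {ω | (X ω ∩ B).ncard = 0}
  set p₁ := P.real {ω | (X ω ∩ B).ncard = 1}
  rw [covariance_eq_sub hF hg, hmean, mul_zero, sub_zero]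
  simp_rw [Pi.mul_apply]
  rw [integral_congr_ae (Filter.Eventually.of_forall fun ω =>
    maxColored_mul_emptyShellScore hk hr hC (hX.finite_inter ω C hCb) hdist p₀ p₁),
    integral_add (f := fun ω => _ * _) (hFD.integrable_mul hg) (i1.const_mul _), integral_const_mul, e1]
  have hind : IndepFun (fun ω => (maxColored k r (D ∩ X ω) : ℝ))
      (fun ω => emptyShellScore p₀ p₁ (X ω ∩ S).ncard (X ω ∩ B).ncard) P := by
    refine hX.indepFun_of_disjoint hDb (hSb.union hBb) hD (hS.union hB) hDSB ?_
      (measurable_emptyShellScore hS hB Set.subset_union_left Set.subset_union_right p₀ p₁)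
    exact (measurable_from_nat (f := fun n : ℕ => (n : ℝ))).comp
      (measurable_maxColored_countSigma (fun ω => hX.finite_inter ω D hDb) hD hk r)
  rw [hind.integral_fun_mul_eq_mul_integral hFD.aestronglyMeasurable hg.aestronglyMeasurable,
    hmean, mul_zero, zero_add]

end Local

/-! ### Blocks and cores. -/

section Geometry

variable {d : ℕ}

/-- The half-open cube of side `3` with lower corner `3 z`. -/
def block (z : Fin d → ℕ) : Set (EuclideanSpace ℝ (Fin d)) :=
  {x | ∀ i, x i ∈ Set.Ico (3 * (z i : ℝ)) (3 * z i + 3)}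

/-- The closed cube of side `1 / 2` in the centre of `block z`. -/
def core (z : Fin d → ℕ) : Set (EuclideanSpace ℝ (Fin d)) :=
  {x | ∀ i, x i ∈ Set.Icc (3 * (z i : ℝ) + 5 / 4) (3 * z i + 7 / 4)}

theorem measurableSet_setOf_forall_coord {s : Fin d → Set ℝ} (hs : ∀ i, MeasurableSet (s i)) :
    MeasurableSet {x : EuclideanSpace ℝ (Fin d) | ∀ i, x i ∈ s i} := by
  rw [Set.ofPred_forall]
  exact MeasurableSet.iInter fun i => (by fun_prop : Measurable
    fun x : EuclideanSpace ℝ (Fin d) => x i) (hs i)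

theorem measurableSet_block (z : Fin d → ℕ) : MeasurableSet (block z) :=
  measurableSet_setOf_forall_coord fun _ => measurableSet_Ico

theorem measurableSet_core (z : Fin d → ℕ) : MeasurableSet (core z) :=
  measurableSet_setOf_forall_coord fun _ => measurableSet_Icc

theorem measurableSet_cube (t : ℝ) : MeasurableSet (cube d t) :=
  measurableSet_setOf_forall_coord fun _ => measurableSet_Icc

theorem isBounded_cube (t : ℝ) : Bornology.IsBounded (cube d t) := by
  have h : IsCompact (Set.univ.pi fun _ : Fin d => Set.Icc (0 : ℝ) t) :=
    isCompact_univ_pi fun _ => isCompact_Icc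
  have h' := (EuclideanSpace.equiv (Fin d) ℝ).toHomeomorph.isCompact_preimage.2 h
  refine h'.isBounded.subset fun x hx => ?_
  intro i _
  exact hx i

theorem core_subset_block (z : Fin d → ℕ) : core z ⊆ block z := fun x hx i =>
  ⟨by linarith [(hx i).1], by linarith [(hx i).2]⟩

theorem block_subset_cube {z : Fin d → ℕ} {m : ℕ} (hz : ∀ i, z i < m) {t : ℝ}
    (ht : 3 * (m : ℝ) ≤ t) : block z ⊆ cube d t := by
  intro x hx i
  have h : (z i : ℝ) + 1 ≤ m := by exact_mod_cast hz i
  have := Nat.cast_nonneg (α := ℝ) (z i)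
  exact ⟨by linarith [(hx i).1], by linarith [(hx i).2]⟩

theorem isBounded_block (z : Fin d → ℕ) : Bornology.IsBounded (block z) :=
  (isBounded_cube _).subset <| block_subset_cube (m := ∑ i, z i + 1)
    (fun i => Nat.lt_succ_of_le (Finset.single_le_sum (fun _ _ => Nat.zero_le _)
      (Finset.mem_univ i))) le_rfl

theorem disjoint_block {z w : Fin d → ℕ} (h : z ≠ w) : Disjoint (block z) (block w) := by
  refine Set.disjoint_left.2 fun x hx hy => h (funext fun i => ?_)
  have h1 : (z i : ℝ) < w i + 1 := by linarith [(hx i).1, (hy i).2]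
  have h2 : (w i : ℝ) < z i + 1 := by linarith [(hy i).1, (hx i).2]
  have h1' : z i < w i + 1 := by exact_mod_cast h1
  have h2' : w i < z i + 1 := by exact_mod_cast h2
  omega

/-- In every coordinate the core keeps a margin of `5 / 4` from the faces of its block, and a point
outside the block violates some coordinate constraint. -/
theorem one_lt_dist_of_mem_core {z : Fin d → ℕ} {x y : EuclideanSpace ℝ (Fin d)}
    (hx : x ∈ core z) (hy : y ∉ block z) : 1 < dist x y := by
  simp only [block, Set.mem_ofPred_eq, not_forall] at hy
  obtain ⟨i, hi⟩ := hy
  have h : |x i - y i| ≤ dist x y := by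
    rw [dist_eq_norm]
    simpa using PiLp.norm_apply_le (x - y) i
  refine lt_of_lt_of_le ?_ h
  rw [lt_abs]
  by_cases h' : 3 * (z i : ℝ) ≤ y i
  · right
    have : 3 * (z i : ℝ) + 3 ≤ y i := by
      by_contra! h''
      exact hi ⟨h', h''⟩
    linarith [(hx i).2]
  · left
    linarith [(hx i).1]

/-- Writing cores as translates makes their volumes, hence the probabilities attached to them,
independent of `z`. -/
theorem core_eq_preimage (z : Fin d → ℕ) :
    core z = (fun x => x + -WithLp.toLp 2 fun i => 3 * (z i : ℝ)) ⁻¹' core 0 := by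
  ext x
  simp only [core, Set.mem_ofPred_eq, Set.mem_preimage, Set.mem_Icc]
  refine forall_congr' fun i => ?_
  simp only [PiLp.add_apply, PiLp.neg_apply, Pi.zero_apply, Nat.cast_zero]
  constructor <;> rintro ⟨h1, h2⟩ <;> constructor <;> linarith

theorem block_eq_preimage (z : Fin d → ℕ) :
    block z = (fun x => x + -WithLp.toLp 2 fun i => 3 * (z i : ℝ)) ⁻¹' block 0 := by
  ext x
  simp only [block, Set.mem_ofPred_eq, Set.mem_preimage, Set.mem_Ico]
  refine forall_congr' fun i => ?_
  simp only [PiLp.add_apply, PiLp.neg_apply, Pi.zero_apply, Nat.cast_zero]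
  constructor <;> rintro ⟨h1, h2⟩ <;> constructor <;> linarith

theorem volume_real_core (z : Fin d → ℕ) : volume.real (core z) = volume.real (core (d := d) 0) := by
  rw [core_eq_preimage z, measureReal_def, measure_preimage_add_right, ← measureReal_def]

theorem volume_real_block_diff_core (z : Fin d → ℕ) :
    volume.real (block z \ core z) = volume.real (block (d := d) 0 \ core 0) := by
  rw [core_eq_preimage z, block_eq_preimage z, ← Set.preimage_sdiff, measureReal_def,
    measure_preimage_add_right, ← measureReal_def]

theorem volume_real_core_pos : 0 < volume.real (core (d := d) 0) := by
  have hopen : IsOpen {x : EuclideanSpace ℝ (Fin d) | ∀ i, x i ∈ Set.Ioo (5 / 4 : ℝ) (7 / 4)} := by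
    rw [Set.ofPred_forall]
    exact isOpen_iInter_of_finite fun i => isOpen_Ioo.preimage (by fun_prop)
  have hne : {x : EuclideanSpace ℝ (Fin d) | ∀ i, x i ∈ Set.Ioo (5 / 4 : ℝ) (7 / 4)}.Nonempty :=
    ⟨WithLp.toLp 2 fun _ => 3 / 2, fun i => by norm_num⟩
  refine ENNReal.toReal_pos ?_
    (((isBounded_block 0).subset (core_subset_block 0)).measure_lt_top).ne
  have hsub : {x : EuclideanSpace ℝ (Fin d) | ∀ i, x i ∈ Set.Ioo (5 / 4 : ℝ) (7 / 4)} ⊆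
      core 0 := fun x hx i => by
    have := hx i
    simp only [Pi.zero_apply, Nat.cast_zero]
    exact ⟨by linarith [this.1], by linarith [this.2]⟩
  exact ((hopen.measure_pos volume hne).trans_le (measure_mono hsub)).ne'

end Geometry

/-! ### Assembly of the variance bound. -/

/-- The variance of `coloredCount` is bounded below by a positive multiple of the number of
disjoint blocks in the cube. -/
theorem IsPoissonProcess.exists_mul_pow_le_variance {d k : ℕ} (hk : 0 < k) {lam : ℝ}
    (hlam : 0 < lam) {Ω : Type*} [MeasurableSpace Ω] {P : Measure Ω} [IsProbabilityMeasure P]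
    {X : Ω → Set (EuclideanSpace ℝ (Fin d))} (hX : IsPoissonProcess lam X P) :
    ∃ c : ℝ, 0 < c ∧ ∀ (m : ℕ) (t : ℝ), 3 * (m : ℝ) ≤ t →
      c * (m : ℝ) ^ d ≤ Var[coloredCount k X t; P] := by
  set a := (lam * volume.real (core (d := d) 0)).toNNReal with ha
  set b := (lam * volume.real (block (d := d) 0 \ core 0)).toNNReal with hb
  have ha_pos : 0 < a := Real.toNNReal_pos.2 (mul_pos hlam volume_real_core_pos)
  set p₀ := (poissonMeasure a).real {0} with hp₀
  set p₁ := (poissonMeasure a).real {1} with hp₁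
  set q := (poissonMeasure b).real {0} with hq
  -- The Poisson mass at `0` is an exponential, so positivity of `b` is not needed.
  have hq_pos : 0 < q := by rw [hq, poissonMeasure_real_singleton]; simp [Real.exp_pos]
  have hp₀_pos : 0 < p₀ := poissonMeasure_real_singleton_pos 0 ha_pos
  have hp₁_pos : 0 < p₁ := poissonMeasure_real_singleton_pos 1 ha_pos
  -- This is the square of the common covariance of the count with a block score.
  refine ⟨(p₀ * (q * p₁)) ^ 2, by positivity, fun m t ht => ?_⟩
  have hBb := fun z : Fin d → ℕ => (isBounded_block z).subset (core_subset_block z)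
  have hSb := fun z : Fin d → ℕ => (isBounded_block z).subset (s := block z \ core z)
    Set.sdiff_subset
  have hBm := measurableSet_core (d := d)
  have hSm := fun z : Fin d → ℕ => (measurableSet_block z).diff (hBm z)
  have e₀ : ∀ z : Fin d → ℕ, P.real {ω | (X ω ∩ core z).ncard = 0} = p₀ := fun z => by
    rw [hX.measureReal_ncard_eq (hBb z) (hBm z), volume_real_core]
  have e₁ : ∀ z : Fin d → ℕ, P.real {ω | (X ω ∩ core z).ncard = 1} = p₁ := fun z => by
    rw [hX.measureReal_ncard_eq (hBb z) (hBm z), volume_real_core]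
  have eq : ∀ z : Fin d → ℕ, P.real {ω | (X ω ∩ (block z \ core z)).ncard = 0} = q := fun z => by
    rw [hX.measureReal_ncard_eq (hSb z) (hSm z), volume_real_block_diff_core]
  let g : (Fin d → ℕ) → Ω → ℝ := fun z ω =>
    emptyShellScore p₀ p₁ (X ω ∩ (block z \ core z)).ncard (X ω ∩ core z).ncard
  have hp₀_le : p₀ ≤ 1 := measureReal_le_one
  have hp₁_le : p₁ ≤ 1 := measureReal_le_one
  have hg : ∀ z, MemLp (g z) 2 P := fun z =>
    hX.memLp_emptyShellScore (hSb z) (hBb z) (hSm z) (hBm z) hp₀_pos.le hp₀_le hp₁_pos.le hp₁_le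
  let ζ : (Fin d → Fin m) → Fin d → ℕ := fun z i => z i
  have hζ : Function.Injective ζ := fun z w h => funext fun i => Fin.ext (congrFun h i)
  have hmain := sq_mul_card_le_variance (P := P) (c := p₀ * (q * p₁))
    (hX.memLp_maxColored (isBounded_cube t) (measurableSet_cube t) hk 1) (g := fun z => g (ζ z))
    (fun z => hg _) ?_ ?_ ?_
  · rw [Fintype.card_fun, Fintype.card_fin, Fintype.card_fin, Nat.cast_pow] at hmain
    exact hmain
  · intro z w hzw
    refine IndepFun.covariance_eq_zero ?_ (hg _) (hg _)
    exact hX.indepFun_of_disjoint (isBounded_block _) (isBounded_block _) (measurableSet_block _)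
      (measurableSet_block _) (disjoint_block (hζ.ne hzw))
      (measurable_emptyShellScore (hSm _) (hBm _) Set.sdiff_subset (core_subset_block _) _ _)
      (measurable_emptyShellScore (hSm _) (hBm _) Set.sdiff_subset (core_subset_block _) _ _)
  · intro z
    refine (variance_le_expectation_sq (hg _).aestronglyMeasurable).trans ?_
    calc ∫ ω, (g (ζ z) ^ 2) ω ∂P ≤ ∫ _ω, (1 : ℝ) ∂P := by
          refine integral_mono (hg _).integrable_sq (integrable_const 1) fun ω => ?_
          rw [Pi.pow_apply, sq_le_one_iff_abs_le_one]
          exact abs_emptyShellScore_le hp₀_pos.le hp₀_le hp₁_pos.le hp₁_le _ _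
      _ = 1 := by simp
  · intro z
    have hsub : block (ζ z) ⊆ cube d t := block_subset_cube (fun i => (z i).2) ht
    have hun : block (ζ z) \ core (ζ z) ∪ core (ζ z) = block (ζ z) :=
      Set.sdiff_union_of_subset (core_subset_block _)
    have := hX.covariance_maxColored_emptyShellScore hk zero_le_one (C := cube d t)
      (D := cube d t \ block (ζ z)) (S := block (ζ z) \ core (ζ z)) (B := core (ζ z))
      (by rw [hun, Set.sdiff_union_of_subset hsub]) (isBounded_cube t)
      ((measurableSet_cube t).diff (measurableSet_block _)) (hSm _) (hBm _)
      Set.disjoint_sdiff_left (by rw [hun]; exact Set.disjoint_sdiff_left)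
      fun x hx y hy => one_lt_dist_of_mem_core hx hy.2
    rw [e₀, e₁, eq] at this
    exact this

theorem lemma1 (d k : ℕ) (hd : 1 ≤ d) (hk : 1 ≤ k) (lam : ℝ) (hlam : 0 < lam)
    {Ω : Type*} [MeasurableSpace Ω] (P : Measure Ω) [IsProbabilityMeasure P]
    (X : Ω → Set (EuclideanSpace ℝ (Fin d))) (hX : IsPoissonProcess lam X P) :
    (∀ t : ℝ, 3 < t → MemLp (coloredCount k X t) 2 P) ∧
      0 < ⨅ t : Set.Ioi (3 : ℝ), variance (coloredCount k X t) P / (t : ℝ) ^ d := by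
  refine ⟨fun t _ => hX.memLp_maxColored (isBounded_cube t) (measurableSet_cube t) hk 1, ?_⟩
  obtain ⟨c, hc, hvar⟩ := hX.exists_mul_pow_le_variance (k := k) hk hlam
  have : Nonempty (Set.Ioi (3 : ℝ)) := ⟨⟨4, by norm_num⟩⟩
  -- As `t / 3 > 1`, its floor is at least half of it, so there are at least `t / 6` blocks along
  -- each side.
  refine lt_of_lt_of_le (b := c * (1 / 6) ^ d) (by positivity) (le_ciInf fun t => ?_)
  have ht : (3 : ℝ) < t := t.2
  have ht0 : (0 : ℝ) < t := by linarith
  have hfloor : 3 * (⌊(t : ℝ) / 3⌋₊ : ℝ) ≤ t := by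
    linarith [Nat.floor_le (show 0 ≤ (t : ℝ) / 3 by positivity)]
  have hfloor' : (1 / 6 : ℝ) * t ≤ ⌊(t : ℝ) / 3⌋₊ := by
    have h1 : (1 : ℝ) ≤ ⌊(t : ℝ) / 3⌋₊ := by
      exact_mod_cast Nat.le_floor (by push_cast; linarith)
    linarith [Nat.lt_floor_add_one ((t : ℝ) / 3)]
  rw [le_div_iff₀ (by positivity), mul_assoc, ← mul_pow]
  refine le_trans ?_ (hvar _ t hfloor)
  gcongr
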